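/- Let $\mu_0,p_0,\eta>0$ be real numbers. Then there exist constants $c_1,c_2,c_3,c_4,c_5,c_6>0$, depending only on $\mu_0,p_0,\eta$, such that the following holds. Let $d_1,d_2,m$ be natural numbers and let $\mathcal I\subseteq\{1,\dots,m\}$ satisfy $|\mathcal I|<m/2$. Let $\ell\in\mathbb R^{d_1}$ and $r\in\mathbb R^{d_2}$ be independent random vectors that are $\eta$-sub-gaussian, meaning that $$\mathbb E\exp\left(\langle u,\ell\rangle^2/\eta^2\right)\le 2\quad\text{and}\quad \mathbb E\exp\left(\langle v,r\rangle^2/\eta^2\right)\le 2$$ for all unit vectors $u\in\mathbb R^{d_1}$, $v\in\mathbb R^{d_2}$, and that satisfy the nondegeneracy condition $$\inf_{X\in\mathbb R^{d_1\times d_2}:\ \mathrm{rank}\,X\le 2,\ \|X\|_F=1}\mathbb P\left(|\ell^\top X r|\ge\mu_0\right)\ge p_0 .$$ Let $(\ell_1,r_1),\dots,(\ell_m,r_m)$ be independent copies of $(\ell,r)$ and define the random linear map $\mathcal A\colon\mathbb R^{d_1\times d_2}\to\mathbb R^m$ by $\mathcal A(X)=(\ell_i^\top X r_i)_{i=1}^m$.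 For $\mathcal J\subseteq\{1,\dots,m\}$ write $\|\mathcal A_{\mathcal J}(X)\|_1=\sum_{i\in\mathcal J}|\ell_i^\top X r_i|$, and $\|\mathcal A(X)\|_1$ for $\mathcal J=\{1,\dots,m\}$. If $$m\ \ge\ \frac{c_1(d_1+d_2+1)}{(1-2|\mathcal I|/m)^2}\,\ln\left(c_2+\frac{c_2}{1-2|\mathcal I|/m}\right),$$ then, with probability at least $1-4\exp\left(-c_3(1-2|\mathcal I|/m)^2m\right)$, every matrix $X\in\mathbb R^{d_1\times d_2}$ of rank at most two satisfies both $$c_4\|X\|_F\ \le\ \frac1m\|\mathcal A(X)\|_1\ \le\ c_5\|X\|_F$$ and $$\frac1m\Big[\|\mathcal A_{\mathcal I^c}(X)\|_1-\|\mathcal A_{\mathcal I}(X)\|_1\Big]\ \ge\ c_6\Big(1-\frac{2|\mathcal I|}{m}\Big)\|X\|_F .$$ -/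

import Mathlib

open MeasureTheory ProbabilityTheory
open scoped Matrix ENNReal

/- Matrices carry the Frobenius norm throughout. -/
attribute [local instance] Matrix.frobeniusNormedAddCommGroup

/-- A random vector `Z` in `ℝ^d` is `η`-sub-gaussian if `𝔼 exp(⟨u, Z⟩² / η²) ≤ 2` for every
vector `u` of the unit sphere. The expectation is a Lebesgue integral with values in `[0, ∞]`. -/
def IsSubGaussianVector {Ω : Type*} [MeasurableSpace Ω] {d : ℕ} (η : ℝ)
    (Z : Ω → EuclideanSpace ℝ (Fin d)) (P : Measure Ω) : Prop :=
  AEMeasurable Z P ∧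
    ∀ u : EuclideanSpace ℝ (Fin d), ‖u‖ = 1 →
      ∫⁻ ω, ENNReal.ofReal (Real.exp ((inner ℝ u (Z ω)) ^ 2 / η ^ 2)) ∂P ≤ 2

/-- The linear measurement map `𝒜(X) = (ℓᵢᵀ X rᵢ)ᵢ`. -/
def measurementMap {d₁ d₂ m : ℕ} (l : Fin m → EuclideanSpace ℝ (Fin d₁))
    (r : Fin m → EuclideanSpace ℝ (Fin d₂)) :
    Matrix (Fin d₁) (Fin d₂) ℝ →ₗ[ℝ] (Fin m → ℝ) where
  toFun X := fun i => (l i).ofLp ⬝ᵥ (X *ᵥ (r i).ofLp)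
  map_add' X Y := by
    funext i
    simp [Matrix.add_mulVec, dotProduct_add]
  map_smul' a X := by
    funext i
    simp [Matrix.smul_mulVec, dotProduct_smul]

/-- The nondegeneracy condition
`inf {ℙ(|ℓᵀ X r| ≥ μ₀) : rank X ≤ 2, ‖X‖_F = 1} ≥ p₀` on a pair of random vectors. -/
def IsNondegenerate {Ω : Type*} [MeasurableSpace Ω] {d₁ d₂ : ℕ} (μ₀ p₀ : ℝ)
    (l : Ω → EuclideanSpace ℝ (Fin d₁)) (r : Ω → EuclideanSpace ℝ (Fin d₂))
    (P : Measure Ω) : Prop :=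
  ENNReal.ofReal p₀ ≤
    ⨅ (X : Matrix (Fin d₁) (Fin d₂) ℝ) (_ : X.rank ≤ 2) (_ : ‖X‖ = 1),
      P {ω | μ₀ ≤ |(l ω).ofLp ⬝ᵥ (X *ᵥ (r ω).ofLp)|}

/-- The fully random measurement model: the vectors `L i` and `R i` are i.i.d. realizations
(on `(Ω, P)`) of independent `η`-sub-gaussian random vectors `l` and `r` (on `(Ω', P')`) which
satisfy the nondegeneracy condition with parameters `μ₀`, `p₀`. -/
structure IsRandomMeasurementModel {Ω Ω' : Type*} [MeasurableSpace Ω] [MeasurableSpace Ω']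
    {d₁ d₂ m : ℕ} (μ₀ p₀ η : ℝ)
    (l : Ω' → EuclideanSpace ℝ (Fin d₁)) (r : Ω' → EuclideanSpace ℝ (Fin d₂)) (P' : Measure Ω')
    (L : Fin m → Ω → EuclideanSpace ℝ (Fin d₁)) (R : Fin m → Ω → EuclideanSpace ℝ (Fin d₂))
    (P : Measure Ω) : Prop where
  subGaussian_left : IsSubGaussianVector η l P'
  subGaussian_right : IsSubGaussianVector η r P'
  indep_left_right : IndepFun l r P'
  nondegenerate : IsNondegenerate μ₀ p₀ l r P'
  iIndep : iIndepFun (fun i ω => (L i ω, R i ω)) P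
  identDistrib : ∀ i, IdentDistrib (fun ω => (L i ω, R i ω)) (fun ω => (l ω, r ω)) P P'

/-!
The proof is a net argument that uses nothing about random matrices beyond exponential moments.

A matrix `X` of rank at most two and Frobenius norm one is `∑ₖ uₖ wₖᵀ` with two pairs of vectors in
the unit balls (`exists_eq_smul_sumOuter_of_rank_le_two`; an orthonormal basis of the range serves
for the `uₖ`, no singular value decomposition is needed). Hence measurements are sums of two
products `⟨uₖ, l⟩ ⟨wₖ, r⟩`, and two facts about the random vectors suffice.

* With probability `1 - 2 exp (-m)`, `∑ᵢ ⟨x, lᵢ⟩² ≤ C m ‖x‖²` and `∑ᵢ ⟨y, rᵢ⟩² ≤ C m ‖y‖²`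
  for all `x`, `y` (`exists_measureReal_le_forall_sum_inner_sq_le`). By Cauchy-Schwarz
  `∑ᵢ |⟨x, lᵢ⟩ ⟨y, rᵢ⟩| ≤ C m ‖x‖ ‖y‖`. This gives the upper bound for `‖𝒜(X)‖₁`, and it shows that
  `‖𝒜(X)‖₁ / m` changes by `O(ε)` when the factors move by `ε`, which makes nets work although the
  difference of two matrices of rank two need not have rank two.

* For a fixed `X` and weights `sᵢ ∈ [-1, 1]` with sum `δ m`, the signed sum `∑ᵢ sᵢ |lᵢᵀ X rᵢ|` has
  mean `δ m 𝔼|lᵀ X r| ≥ δ m μ₀ p₀ ‖X‖`. The variables `|lᵢᵀ X rᵢ|` are sub-exponential with moment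
  generating function at most `exp (t 𝔼Y + O(t²))`, so Chernoff's bound with a parameter
  proportional to `δ` shows that the sum falls below half of its mean with probability at most
  `exp (-b δ² m)` (`IsRandomMeasurementModel.measureReal_signedSum_le`).

A net of the factors at scale `ε = e δ` has at most `(1 + 2 / (e δ)) ^ (2 (d₁ + d₂))` elements, which
the assumption on `m` makes smaller than `exp (b δ² m / 2)`. A union bound and the perturbation
estimate turn the second fact into a lower bound for all `X` at once
(`IsRandomMeasurementModel.exists_forall_le_signedSum`). It is applied twice: with the signs `-1` on
`I` and `1` off `I`, where `δ = 1 - 2 |I| / m`, and with all signs `1`, where `δ = 1`, to bound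
`‖𝒜(X)‖₁` from below. Together with the bounds for `lᵢ` and `rᵢ` there are four failure events.
-/

/-! ### Nets of the unit ball -/

theorem card_le_of_separated_unitBall {E : Type*} [NormedAddCommGroup E] [NormedSpace ℝ E]
    [FiniteDimensional ℝ E] {ε : ℝ} (hε : 0 < ε) (s : Finset E) (hs : ∀ c ∈ s, ‖c‖ ≤ 1)
    (h : ∀ c ∈ s, ∀ d ∈ s, c ≠ d → ε < ‖c - d‖) :
    (s.card : ℝ) ≤ (1 + 2 / ε) ^ Module.finrank ℝ E := by
  borelize E
  let μ : Measure E := Measure.addHaar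
  -- The balls of radius `ε / 2` around the points are disjoint and lie in a ball of radius
  -- `1 + ε / 2`; volumes are compared.
  have hδ : 0 < ε / 2 := by positivity
  have hρ : 0 < 1 + ε / 2 := by positivity
  have hdisj : Set.Pairwise (s : Set E)
      (Function.onFun Disjoint fun c => Metric.ball (c : E) (ε / 2)) := by
    rintro c hc d hd hcd
    apply Metric.ball_disjoint_ball
    rw [dist_eq_norm]
    linarith [h c hc d hd hcd]
  have hsub : (⋃ c ∈ s, Metric.ball (c : E) (ε / 2)) ⊆ Metric.ball (0 : E) (1 + ε / 2) := by
    refine Set.iUnion₂_subset fun x hx => ?_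
    apply Metric.ball_subset_ball'
    rw [dist_zero_right]
    linarith [hs x hx]
  have hvol : (s.card : ℝ≥0∞) * ENNReal.ofReal ((ε / 2) ^ Module.finrank ℝ E) *
      μ (Metric.ball 0 1) ≤
      ENNReal.ofReal ((1 + ε / 2) ^ Module.finrank ℝ E) * μ (Metric.ball 0 1) := by
    have := measure_mono (μ := μ) hsub
    rw [measure_biUnion_finset hdisj fun c _ => measurableSet_ball] at this
    simpa only [μ.addHaar_ball_of_pos _ hδ, μ.addHaar_ball_of_pos _ hρ, Finset.sum_const,
      nsmul_eq_mul, mul_assoc] using this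
  have hcard : (s.card : ℝ≥0∞) * ENNReal.ofReal ((ε / 2) ^ Module.finrank ℝ E) ≤
      ENNReal.ofReal ((1 + ε / 2) ^ Module.finrank ℝ E) :=
    (ENNReal.mul_le_mul_iff_left (Metric.measure_ball_pos _ _ zero_lt_one).ne'
      measure_ball_lt_top.ne).1 hvol
  have := ENNReal.toReal_le_of_le_ofReal (pow_nonneg hρ.le _) hcard
  rw [ENNReal.toReal_mul, ENNReal.toReal_natCast, ENNReal.toReal_ofReal (by positivity),
    ← le_div_iff₀ (by positivity), ← div_pow] at this
  convert! this using 2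
  field_simp
  ring

theorem exists_finset_net_unitBall (E : Type*) [NormedAddCommGroup E] [NormedSpace ℝ E]
    [FiniteDimensional ℝ E] {ε : ℝ} (hε : 0 < ε) :
    ∃ N : Finset E, (∀ x ∈ N, ‖x‖ ≤ 1) ∧ (∀ x : E, ‖x‖ ≤ 1 → ∃ y ∈ N, ‖x - y‖ ≤ ε) ∧
      (N.card : ℝ) ≤ (1 + 2 / ε) ^ Module.finrank ℝ E := by
  classical
  -- A separated subset of the ball of maximal cardinality is a net.
  let Sep : ℕ → Prop := fun n => ∃ s : Finset E, s.card = n ∧ (∀ c ∈ s, ‖c‖ ≤ 1) ∧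
    ∀ c ∈ s, ∀ d ∈ s, c ≠ d → ε < ‖c - d‖
  have hbound : ∀ n, Sep n → n ≤ ⌊(1 + 2 / ε) ^ Module.finrank ℝ E⌋₊ := by
    rintro n ⟨s, rfl, hs, h⟩
    exact Nat.le_floor (card_le_of_separated_unitBall hε s hs h)
  have h0 : Sep 0 := ⟨∅, by simp⟩
  obtain ⟨N, hNc, hN1, hN2⟩ : Sep (Nat.findGreatest Sep ⌊(1 + 2 / ε) ^ Module.finrank ℝ E⌋₊) :=
    Nat.findGreatest_spec (Nat.zero_le _) h0
  refine ⟨N, hN1, fun x hx => ?_, card_le_of_separated_unitBall hε N hN1 hN2⟩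
  by_contra! hcon
  have hxN : x ∉ N := fun hxN => by
    have := hcon x hxN
    simp only [sub_self, norm_zero] at this
    linarith
  have hsep : Sep (N.card + 1) := by
    refine ⟨insert x N, Finset.card_insert_of_notMem hxN, ?_, ?_⟩
    · simpa using ⟨hx, hN1⟩
    · intro c hc d hd hcd
      rcases Finset.mem_insert.1 hc with rfl | hc' <;>
        rcases Finset.mem_insert.1 hd with rfl | hd'
      · exact absurd rfl hcd
      · exact hcon d hd'
      · rw [norm_sub_rev]
        exact hcon c hc'
      · exact hN2 c hc' d hd' hcd
  have := Nat.le_findGreatest (hbound _ hsep) hsep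
  omega

theorem ContinuousLinearMap.opNorm_le_of_half_net {E F : Type*} [NormedAddCommGroup E]
    [NormedSpace ℝ E] [NormedAddCommGroup F] [NormedSpace ℝ F] (T : E →L[ℝ] F) {N : Set E} {K : ℝ}
    (hK : 0 ≤ K) (hN : ∀ x : E, ‖x‖ ≤ 1 → ∃ y ∈ N, ‖x - y‖ ≤ 1 / 2) (hT : ∀ y ∈ N, ‖T y‖ ≤ K) :
    ‖T‖ ≤ 2 * K := by
  suffices ‖T‖ ≤ K + ‖T‖ / 2 by linarith
  refine ContinuousLinearMap.opNorm_le_of_unit_norm (by positivity) fun x hx => ?_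
  obtain ⟨y, hy, hxy⟩ := hN x hx.le
  calc ‖T x‖ = ‖T y + T (x - y)‖ := by rw [← map_add]; simp
    _ ≤ ‖T y‖ + ‖T‖ * ‖x - y‖ := (norm_add_le _ _).trans (by gcongr; exact T.le_opNorm _)
    _ ≤ K + ‖T‖ * (1 / 2) := by gcongr; exact hT y hy
    _ = K + ‖T‖ / 2 := by ring

/-! ### Exponential moments and the Chernoff bound -/

theorem measureReal_sum_ge_le_exp {Ω ι : Type*} [MeasurableSpace Ω] {P : Measure Ω} [Fintype ι]
    {X : ι → Ω → ℝ} (hind : iIndepFun X P) (hX : ∀ i, AEMeasurable (X i) P) (a : ι → ℝ)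
    (hint : ∀ i, Integrable (fun ω => Real.exp (X i ω)) P)
    (ha : ∀ i, ∫ ω, Real.exp (X i ω) ∂P ≤ Real.exp (a i)) (c : ℝ) :
    P.real {ω | c ≤ ∑ i, X i ω} ≤ Real.exp (∑ i, a i - c) := by
  have := hind.isProbabilityMeasure
  have hi : Integrable (fun ω => Real.exp (1 * (∑ i, X i) ω)) P := by
    -- A positive product of moment generating functions cannot be the junk value `0`.
    by_contra hni
    have h0 : mgf (∑ i, X i) P 1 = 0 := mgf_undef hni
    rw [hind.mgf_sum₀ hX] at h0
    refine (Finset.prod_pos fun i _ => mgf_pos ?_).ne' h0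
    simpa using hint i
  have h := measure_ge_le_exp_mul_mgf (μ := P) (X := ∑ i, X i) c zero_le_one hi
  rw [hind.mgf_sum₀ hX] at h
  calc P.real {ω | c ≤ ∑ i, X i ω} = P.real {ω | c ≤ (∑ i, X i) ω} := by simp
    _ ≤ _ := h
    _ ≤ Real.exp (-1 * c) * ∏ i, Real.exp (a i) := by
        gcongr with i
        · exact fun i _ => mgf_nonneg
        · simpa [mgf] using ha i
    _ = Real.exp (∑ i, a i - c) := by
        rw [← Real.exp_sum, ← Real.exp_add]
        ring_nf


theorem exp_mul_le_of_nonneg {θ t y : ℝ} (hθ : 0 < θ) (ht : |t| ≤ θ / 2) (hy : 0 ≤ y) :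
    Real.exp (t * y) ≤ 1 + t * y + 8 / θ ^ 2 * t ^ 2 * Real.exp (θ * y) := by
  have h1 : Real.exp (t * y) ≤ 1 + t * y + (t * y) ^ 2 * Real.exp (|t * y|) := by
    have h := Complex.norm_exp_sub_sum_le_norm_mul_exp (t * y : ℝ) 2
    simp only [Finset.sum_range_succ, Finset.sum_range_zero, ← Complex.ofReal_exp] at h
    norm_num at h
    norm_cast at h
    rw [Real.norm_eq_abs, ← abs_mul, sq_abs] at h
    have := le_abs_self (Real.exp (t * y) - (1 + t * y))
    linarith
  have h2 : |t * y| ≤ θ * y / 2 := by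
    rw [abs_mul, abs_of_nonneg hy]
    nlinarith
  have h3 : y ^ 2 ≤ 8 / θ ^ 2 * Real.exp (θ * y / 2) := by
    have := Real.pow_div_factorial_le_exp (θ * y / 2) (by positivity) 2
    norm_num [Nat.factorial] at this
    rw [div_mul_eq_mul_div, le_div_iff₀ (by positivity)]
    nlinarith
  have h4 : Real.exp (θ * y) = Real.exp (θ * y / 2) * Real.exp (θ * y / 2) := by
    rw [← Real.exp_add]; ring_nf
  calc _ ≤ 1 + t * y + (t * y) ^ 2 * Real.exp (|t * y|) := h1
    _ = 1 + t * y + t ^ 2 * (y ^ 2 * Real.exp (|t * y|)) := by ring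
    _ ≤ 1 + t * y + t ^ 2 * ((8 / θ ^ 2 * Real.exp (θ * y / 2)) * Real.exp (θ * y / 2)) := by
        gcongr
    _ = _ := by rw [h4]; ring

theorem integrable_of_integrable_exp {Ω : Type*} [MeasurableSpace Ω] {P : Measure Ω}
    {Y : Ω → ℝ} {θ : ℝ} (hθ : 0 < θ) (hY : AEMeasurable Y P)
    (hY0 : ∀ ω, 0 ≤ Y ω) (hint : Integrable (fun ω => Real.exp (θ * Y ω)) P) :
    Integrable Y P := by
  refine (hint.const_mul (1 / θ)).mono' hY.aestronglyMeasurable (.of_forall fun ω => ?_)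
  rw [Real.norm_eq_abs, abs_of_nonneg (hY0 ω), div_mul_eq_mul_div, le_div_iff₀ hθ]
  linarith [Real.add_one_le_exp (θ * Y ω)]

theorem integrable_exp_mul_of_abs_le {Ω : Type*} [MeasurableSpace Ω] {P : Measure Ω}
    {Y : Ω → ℝ} {θ t : ℝ} (ht : |t| ≤ θ) (hY : AEMeasurable Y P)
    (hY0 : ∀ ω, 0 ≤ Y ω) (hint : Integrable (fun ω => Real.exp (θ * Y ω)) P) :
    Integrable (fun ω => Real.exp (t * Y ω)) P := by
  refine hint.mono' (by fun_prop) (.of_forall fun ω => ?_)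
  rw [Real.norm_eq_abs, Real.abs_exp]
  gcongr
  · exact hY0 ω
  · exact (le_abs_self t).trans ht

/-- The moment generating function of a nonnegative sub-exponential variable is
`exp (t 𝔼Y + O(t²))` near `0`. -/
theorem integral_exp_mul_le {Ω : Type*} [MeasurableSpace Ω] {P : Measure Ω}
    [IsProbabilityMeasure P] {Y : Ω → ℝ} {θ t : ℝ} (hθ : 0 < θ) (ht : |t| ≤ θ / 2)
    (hY : AEMeasurable Y P) (hY0 : ∀ ω, 0 ≤ Y ω)
    (hint : Integrable (fun ω => Real.exp (θ * Y ω)) P)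
    (h2 : ∫ ω, Real.exp (θ * Y ω) ∂P ≤ 2) :
    ∫ ω, Real.exp (t * Y ω) ∂P ≤ Real.exp (t * (∫ ω, Y ω ∂P) + 16 / θ ^ 2 * t ^ 2) := by
  have hYi := integrable_of_integrable_exp hθ hY hY0 hint
  calc ∫ ω, Real.exp (t * Y ω) ∂P
      ≤ ∫ ω, (1 + t * Y ω + 8 / θ ^ 2 * t ^ 2 * Real.exp (θ * Y ω)) ∂P :=
        integral_mono (integrable_exp_mul_of_abs_le (by linarith) hY hY0 hint)
          (((integrable_const _).add (hYi.const_mul t)).add (hint.const_mul _))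
          fun ω => exp_mul_le_of_nonneg hθ ht (hY0 ω)
    _ = 1 + t * (∫ ω, Y ω ∂P) + 8 / θ ^ 2 * t ^ 2 * ∫ ω, Real.exp (θ * Y ω) ∂P := by
        rw [integral_add (f := fun ω => 1 + t * Y ω)
            ((integrable_const _).add (hYi.const_mul t)) (hint.const_mul _),
          integral_add (integrable_const _) (hYi.const_mul t), integral_const_mul,
          integral_const_mul]
        simp
    _ ≤ 1 + t * (∫ ω, Y ω ∂P) + 8 / θ ^ 2 * t ^ 2 * 2 := by gcongr
    _ ≤ _ := by
        refine le_trans (le_of_eq ?_) (Real.add_one_le_exp _)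
        ring

/-! ### Matrices of rank at most two in factored form -/

/-- The matrix `∑ₖ uₖ wₖᵀ` of rank at most two with factors `uₖ`, `wₖ`, `k = 0, 1`. -/
def sumOuter {d₁ d₂ : ℕ} (u : Fin 2 → EuclideanSpace ℝ (Fin d₁))
    (w : Fin 2 → EuclideanSpace ℝ (Fin d₂)) : Matrix (Fin d₁) (Fin d₂) ℝ :=
  ∑ k, Matrix.vecMulVec (u k).ofLp (w k).ofLp

theorem rank_sumOuter_le {d₁ d₂ : ℕ} (u : Fin 2 → EuclideanSpace ℝ (Fin d₁))
    (w : Fin 2 → EuclideanSpace ℝ (Fin d₂)) : (sumOuter u w).rank ≤ 2 := by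
  have h : sumOuter u w = (Matrix.of fun i k => u k i) * (Matrix.of fun k j => w k j) := by
    ext i j
    simp [sumOuter, Matrix.mul_apply, Matrix.vecMulVec_apply]
  rw [h]
  refine (Matrix.rank_mul_le_left _ _).trans ?_
  simpa using Matrix.rank_le_card_width (Matrix.of fun i k => u k i)

theorem dotProduct_sumOuter_mulVec {d₁ d₂ : ℕ} (u : Fin 2 → EuclideanSpace ℝ (Fin d₁))
    (w : Fin 2 → EuclideanSpace ℝ (Fin d₂)) (a : EuclideanSpace ℝ (Fin d₁))
    (b : EuclideanSpace ℝ (Fin d₂)) :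
    a.ofLp ⬝ᵥ (sumOuter u w *ᵥ b.ofLp) = ∑ k, inner ℝ (u k) a * inner ℝ (w k) b := by
  simp only [sumOuter, Matrix.sum_mulVec, dotProduct_sum, Matrix.vecMulVec_mulVec,
    EuclideanSpace.inner_eq_star_dotProduct, star_trivial]
  refine Finset.sum_congr rfl fun k _ => ?_
  rw [op_smul_eq_smul, dotProduct_smul, smul_eq_mul, mul_comm,
    dotProduct_comm (w k).ofLp]

theorem frobenius_norm_vecMulVec_le {d₁ d₂ : ℕ} (a : EuclideanSpace ℝ (Fin d₁))
    (b : EuclideanSpace ℝ (Fin d₂)) : ‖Matrix.vecMulVec a.ofLp b.ofLp‖ ≤ ‖a‖ * ‖b‖ := by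
  rw [Matrix.vecMulVec_eq Unit]
  refine (Matrix.frobenius_norm_mul _ _).trans_eq ?_
  rw [Matrix.frobenius_norm_replicateCol, Matrix.frobenius_norm_replicateRow]

theorem norm_sumOuter_sub_le {d₁ d₂ : ℕ} {ε : ℝ} {u u' : Fin 2 → EuclideanSpace ℝ (Fin d₁)}
    {w w' : Fin 2 → EuclideanSpace ℝ (Fin d₂)} (hu' : ∀ k, ‖u' k‖ ≤ 1) (hw : ∀ k, ‖w k‖ ≤ 1)
    (hu : ∀ k, ‖u k - u' k‖ ≤ ε) (hw' : ∀ k, ‖w k - w' k‖ ≤ ε) :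
    ‖sumOuter u w - sumOuter u' w'‖ ≤ 4 * ε := by
  have h : sumOuter u w - sumOuter u' w' =
      ∑ k, (Matrix.vecMulVec (u k - u' k).ofLp (w k).ofLp +
        Matrix.vecMulVec (u' k).ofLp (w k - w' k).ofLp) := by
    simp only [sumOuter, ← Finset.sum_sub_distrib]
    refine Finset.sum_congr rfl fun k _ => ?_
    rw [WithLp.ofLp_sub, WithLp.ofLp_sub, Matrix.sub_vecMulVec, Matrix.vecMulVec_sub]
    abel
  rw [h]
  calc _ ≤ ∑ k : Fin 2, (ε * 1 + 1 * ε) := by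
        refine (norm_sum_le _ _).trans (Finset.sum_le_sum fun k _ => (norm_add_le _ _).trans ?_)
        have hε : 0 ≤ ε := (norm_nonneg _).trans (hu k)
        exact add_le_add
          ((frobenius_norm_vecMulVec_le _ _).trans
            (mul_le_mul (hu k) (hw k) (norm_nonneg _) hε))
          ((frobenius_norm_vecMulVec_le _ _).trans
            (mul_le_mul (hu' k) (hw' k) (norm_nonneg _) zero_le_one))
    _ = 4 * ε := by rw [Fin.sum_univ_two]; ring

theorem norm_toLp_vecMul_le {d₁ d₂ : ℕ} (X : Matrix (Fin d₁) (Fin d₂) ℝ)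
    (a : EuclideanSpace ℝ (Fin d₁)) : ‖WithLp.toLp 2 (a.ofLp ᵥ* X)‖ ≤ ‖a‖ * ‖X‖ := by
  have h := Matrix.frobenius_norm_mul (Matrix.replicateRow Unit a.ofLp) X
  rwa [← Matrix.replicateRow_vecMul, Matrix.frobenius_norm_replicateRow,
    Matrix.frobenius_norm_replicateRow] at h

/-- A matrix of rank at most two factors through an orthonormal basis `u` of its range:
`X = ∑ₖ uₖ (Xᵀuₖ)ᵀ`. This replaces a singular value decomposition. -/
theorem exists_eq_sumOuter_of_rank_le_two {d₁ d₂ : ℕ} (X : Matrix (Fin d₁) (Fin d₂) ℝ)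
    (hX : X.rank ≤ 2) :
    ∃ (u : Fin 2 → EuclideanSpace ℝ (Fin d₁)) (w : Fin 2 → EuclideanSpace ℝ (Fin d₂)),
      (∀ k, ‖u k‖ ≤ 1) ∧ (∀ k, ‖w k‖ ≤ ‖X‖) ∧ X = sumOuter u w := by
  let V : Submodule ℝ (EuclideanSpace ℝ (Fin d₁)) := LinearMap.range (Matrix.toEuclideanLin X)
  have hV : Module.finrank ℝ V ≤ 2 := by
    rwa [Matrix.rank_eq_finrank_range_toLin X (EuclideanSpace.basisFun _ ℝ).toBasis
      (EuclideanSpace.basisFun _ ℝ).toBasis, ← Matrix.toEuclideanLin_eq_toLin_orthonormal] at hX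
  let e := stdOrthonormalBasis ℝ V
  let u : Fin 2 → EuclideanSpace ℝ (Fin d₁) :=
    fun k => if h : k.1 < Module.finrank ℝ V then e ⟨k.1, h⟩ else 0
  have hu : ∀ k, ‖u k‖ ≤ 1 := by
    intro k
    by_cases h : k.1 < Module.finrank ℝ V
    · simp only [u, h, dite_true]
      exact (e.orthonormal.1 ⟨k.1, h⟩).le
    · simp [u, h]
  have hsum : ∀ y ∈ V, y = ∑ k, inner ℝ (u k) y • u k := by
    intro y hy
    have h := congrArg V.subtype (e.sum_repr' ⟨y, hy⟩)
    rw [map_sum] at h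
    refine h.symm.trans (Fintype.sum_of_injective (Fin.castLE hV) (Fin.castLE_injective hV) _ _
      (fun k hk => ?_) fun k => ?_)
    · have hk' : ¬ k.1 < Module.finrank ℝ V := fun h' => hk ⟨⟨k.1, h'⟩, rfl⟩
      simp [u, hk']
    · simp [u]
  refine ⟨u, fun k => WithLp.toLp 2 ((u k).ofLp ᵥ* X), hu, fun k => ?_, ?_⟩
  · exact (norm_toLp_vecMul_le X (u k)).trans
      (mul_le_of_le_one_left (norm_nonneg _) (hu k))
  · ext i j
    have h := hsum (Matrix.toEuclideanLin X (EuclideanSpace.single j 1)) ⟨_, rfl⟩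
    have h := congrArg (fun z => z.ofLp i) h
    simp only [Matrix.toLpLin_apply, EuclideanSpace.inner_eq_star_dotProduct, star_trivial,
      PiLp.ofLp_single, Matrix.mulVec_single_one, WithLp.ofLp_sum, WithLp.ofLp_smul,
      Finset.sum_apply, Pi.smul_apply, smul_eq_mul, Matrix.col_apply] at h
    rw [h]
    simp only [sumOuter, Matrix.sum_apply, Matrix.vecMulVec_apply, Matrix.vecMul]
    refine Finset.sum_congr rfl fun k _ => ?_
    rw [mul_comm, dotProduct_comm]
    rfl

/-! ### Sub-gaussian vectors -/

theorem IsSubGaussianVector.of_identDistrib {Ω Ω' : Type*} [MeasurableSpace Ω]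
    [MeasurableSpace Ω'] {P : Measure Ω} {P' : Measure Ω'} {d : ℕ} {η : ℝ}
    {Z : Ω → EuclideanSpace ℝ (Fin d)} {Z' : Ω' → EuclideanSpace ℝ (Fin d)}
    (h : IsSubGaussianVector η Z' P') (hZ : IdentDistrib Z Z' P P') :
    IsSubGaussianVector η Z P := by
  refine ⟨hZ.aemeasurable_fst, fun u hu => ?_⟩
  refine le_of_eq_of_le ?_ (h.2 u hu)
  exact (hZ.comp (u := fun z => ENNReal.ofReal (Real.exp ((inner ℝ u z) ^ 2 / η ^ 2)))
    (by fun_prop)).lintegral_eq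

theorem IsSubGaussianVector.integrable_and_integral_le {Ω : Type*} [MeasurableSpace Ω]
    {P : Measure Ω} [IsProbabilityMeasure P] {d : ℕ} {η : ℝ}
    {Z : Ω → EuclideanSpace ℝ (Fin d)} (h : IsSubGaussianVector η Z P)
    {u : EuclideanSpace ℝ (Fin d)} (hu : ‖u‖ ≤ 1) :
    Integrable (fun ω => Real.exp ((inner ℝ u (Z ω)) ^ 2 / η ^ 2)) P ∧
      ∫ ω, Real.exp ((inner ℝ u (Z ω)) ^ 2 / η ^ 2) ∂P ≤ 2 := by
  have hZ := h.1
  have hmeas : AEStronglyMeasurable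
      (fun ω => Real.exp ((inner ℝ u (Z ω)) ^ 2 / η ^ 2)) P := by
    have h1 : AEMeasurable (fun ω => (inner ℝ u (Z ω) : ℝ)) P := hZ.const_inner
    have : AEMeasurable (fun ω => Real.exp ((inner ℝ u (Z ω)) ^ 2 / η ^ 2)) P := by fun_prop
    exact this.aestronglyMeasurable
  have hlint : ∫⁻ ω, ENNReal.ofReal (Real.exp ((inner ℝ u (Z ω)) ^ 2 / η ^ 2)) ∂P ≤ 2 := by
    rcases eq_or_ne u 0 with rfl | hu0
    · simp
    · have hn : 0 < ‖u‖ := norm_pos_iff.2 hu0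
      refine le_trans (lintegral_mono fun ω => ?_) (h.2 (‖u‖⁻¹ • u) ?_)
      · refine ENNReal.ofReal_le_ofReal (Real.exp_le_exp.2 ?_)
        gcongr ?_ / _
        rw [real_inner_smul_left, mul_pow]
        exact le_mul_of_one_le_left (sq_nonneg _)
          (one_le_pow₀ ((one_le_inv₀ hn).2 hu))
      · rw [norm_smul, norm_inv, norm_norm, inv_mul_cancel₀ hn.ne']
  refine ⟨⟨hmeas, ?_⟩, ?_⟩
  · rw [hasFiniteIntegral_iff_ofReal (.of_forall fun ω => (Real.exp_pos _).le)]
    exact hlint.trans_lt (by simp)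
  · rw [integral_eq_lintegral_of_nonneg_ae (.of_forall fun ω => (Real.exp_pos _).le) hmeas]
    simpa using ENNReal.toReal_mono (by simp) hlint

/-- The sample second moment form of `m ≥ d` independent sub-gaussian vectors is bounded by a
constant multiple of `m ‖u‖²`. The constant comes from `16 = 2² * 4`: the factor `2²` is lost in
passing from a `1/2`-net to the whole ball, and the threshold `4 η² m` beats both the size
`5 ^ d ≤ exp (2 m)` of the net and the exponential moment `2 ^ m ≤ exp m`. -/
theorem exists_measureReal_le_forall_sum_inner_sq_le {Ω : Type*} [MeasurableSpace Ω]
    {P : Measure Ω} [IsProbabilityMeasure P] {d m : ℕ} {η : ℝ} (hη : 0 < η)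
    {Z : Fin m → Ω → EuclideanSpace ℝ (Fin d)} (hind : iIndepFun Z P)
    (hZ : ∀ i, IsSubGaussianVector η (Z i) P) (hdm : d ≤ m) :
    ∃ B : Set Ω, P.real B ≤ Real.exp (-m) ∧
      ∀ ω ∉ B, ∀ u, ∑ i, (inner ℝ u (Z i ω)) ^ 2 ≤ 16 * η ^ 2 * m * ‖u‖ ^ 2 := by
  obtain ⟨N, hN1, hN2, hNc⟩ :=
    exists_finset_net_unitBall (EuclideanSpace ℝ (Fin d)) (ε := 1 / 2) (by norm_num)
  refine ⟨⋃ u ∈ N, {ω | 4 * m ≤ ∑ i, (inner ℝ u (Z i ω)) ^ 2 / η ^ 2}, ?_, fun ω hω => ?_⟩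
  · have hpt : ∀ u ∈ N, P.real {ω | 4 * (m : ℝ) ≤ ∑ i, (inner ℝ u (Z i ω)) ^ 2 / η ^ 2} ≤
        Real.exp (-(3 * m)) := by
      intro u hu
      refine (measureReal_sum_ge_le_exp (X := fun i ω => (inner ℝ u (Z i ω)) ^ 2 / η ^ 2)
        (hind.comp (fun _ z => (inner ℝ u z) ^ 2 / η ^ 2) fun _ => by fun_prop)
        (fun i => ?_) (fun _ => 1)
        (fun i => ((hZ i).integrable_and_integral_le (hN1 u hu)).1) (fun i => ?_) _).trans_eq ?_
      · have h1 : AEMeasurable (fun ω => (inner ℝ u (Z i ω) : ℝ)) P := (hZ i).1.const_inner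
        fun_prop
      · refine ((hZ i).integrable_and_integral_le (hN1 u hu)).2.trans ?_
        linarith [Real.add_one_le_exp 1]
      · simp only [Finset.sum_const, Finset.card_univ, Fintype.card_fin, nsmul_eq_mul]
        ring_nf
    have hcard : (N.card : ℝ) ≤ Real.exp (2 * m) := by
      refine hNc.trans ?_
      have h5 : (1 + 2 / (1 / 2) : ℝ) ≤ Real.exp 2 := by
        have := Real.quadratic_le_exp_of_nonneg (x := 2) (by norm_num)
        linarith
      calc (1 + 2 / (1 / 2) : ℝ) ^ Module.finrank ℝ (EuclideanSpace ℝ (Fin d))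
          ≤ Real.exp 2 ^ d := by
            rw [finrank_euclideanSpace_fin]; gcongr
        _ ≤ Real.exp 2 ^ m := pow_le_pow_right₀ (Real.one_le_exp (by norm_num)) hdm
        _ = Real.exp (2 * m) := by rw [← Real.exp_nat_mul]; ring_nf
    calc _ ≤ ∑ u ∈ N, P.real {ω | 4 * (m : ℝ) ≤ ∑ i, (inner ℝ u (Z i ω)) ^ 2 / η ^ 2} :=
          measureReal_biUnion_finset_le _ _
      _ ≤ N.card * Real.exp (-(3 * m)) := by
          simpa using Finset.sum_le_sum hpt
      _ ≤ Real.exp (2 * m) * Real.exp (-(3 * m)) := by gcongr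
      _ = Real.exp (-m) := by rw [← Real.exp_add]; ring_nf
  · let T : EuclideanSpace ℝ (Fin d) →L[ℝ] EuclideanSpace ℝ (Fin m) :=
      LinearMap.toContinuousLinearMap
        { toFun := fun u => WithLp.toLp 2 fun i => inner ℝ u (Z i ω)
          map_add' := fun u v => by ext i; simp [inner_add_left]
          map_smul' := fun c u => by ext i; simp [real_inner_smul_left] }
    have hT : ∀ u, ‖T u‖ ^ 2 = ∑ i, (inner ℝ u (Z i ω)) ^ 2 := fun u => by
      rw [EuclideanSpace.norm_sq_eq]
      simp [T]
    have hnet : ∀ u ∈ (N : Set (EuclideanSpace ℝ (Fin d))), ‖T u‖ ≤ √(4 * m * η ^ 2) := by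
      intro u hu
      refine Real.le_sqrt_of_sq_le ?_
      rw [hT]
      simp only [Set.mem_iUnion, Set.mem_ofPred_eq, not_exists, not_le] at hω
      have := hω u hu
      rw [← Finset.sum_div, div_lt_iff₀ (by positivity)] at this
      exact this.le
    have hop := T.opNorm_le_of_half_net (by positivity) hN2 hnet
    intro u
    rw [← hT]
    calc ‖T u‖ ^ 2 ≤ (2 * √(4 * m * η ^ 2) * ‖u‖) ^ 2 := by
          gcongr
          exact (T.le_opNorm u).trans (by gcongr)
      _ = 16 * η ^ 2 * m * ‖u‖ ^ 2 := by
          rw [mul_pow, mul_pow, Real.sq_sqrt (by positivity)]; ring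

/-! ### A single measurement -/

theorem measurable_dotProduct_mulVec {d₁ d₂ : ℕ} (X : Matrix (Fin d₁) (Fin d₂) ℝ) :
    Measurable fun p : EuclideanSpace ℝ (Fin d₁) × EuclideanSpace ℝ (Fin d₂) =>
      p.1.ofLp ⬝ᵥ (X *ᵥ p.2.ofLp) := by
  unfold Matrix.mulVec dotProduct
  fun_prop

theorem exp_half_add_le (a b : ℝ) :
    Real.exp ((a + b) / 2) ≤ (Real.exp a + Real.exp b) / 2 := by
  have h1 : Real.exp ((a + b) / 2) = Real.exp (a / 2) * Real.exp (b / 2) := by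
    rw [← Real.exp_add]; ring_nf
  have h2 : ∀ x : ℝ, Real.exp x = Real.exp (x / 2) ^ 2 := fun x => by
    rw [sq, ← Real.exp_add]; ring_nf
  rw [h1, h2 a, h2 b]
  nlinarith [sq_nonneg (Real.exp (a / 2) - Real.exp (b / 2))]

/-- The measurement of a matrix with factors in the unit balls is sub-exponential. By
`|s t| ≤ (s² + t²) / 2` and convexity of `exp` its exponential moment is an average of four
sub-gaussian ones, whatever the joint law of the two vectors. -/
theorem integrable_exp_abs_sumOuter {Ω : Type*} [MeasurableSpace Ω]
    {P : Measure Ω} [IsProbabilityMeasure P] {d₁ d₂ : ℕ} {η : ℝ} (hη : 0 < η)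
    {l : Ω → EuclideanSpace ℝ (Fin d₁)} {r : Ω → EuclideanSpace ℝ (Fin d₂)}
    (hl : IsSubGaussianVector η l P) (hr : IsSubGaussianVector η r P)
    {u : Fin 2 → EuclideanSpace ℝ (Fin d₁)} {w : Fin 2 → EuclideanSpace ℝ (Fin d₂)}
    (hu : ∀ k, ‖u k‖ ≤ 1) (hw : ∀ k, ‖w k‖ ≤ 1) :
    Integrable (fun ω => Real.exp (1 / (2 * η ^ 2) *
      |(l ω).ofLp ⬝ᵥ (sumOuter u w *ᵥ (r ω).ofLp)|)) P ∧
    ∫ ω, Real.exp (1 / (2 * η ^ 2) *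
      |(l ω).ofLp ⬝ᵥ (sumOuter u w *ᵥ (r ω).ofLp)|) ∂P ≤ 2 := by
  have hL := fun k => hl.integrable_and_integral_le (hu k)
  have hR := fun k => hr.integrable_and_integral_le (hw k)
  let E : Fin 2 → Ω → ℝ := fun k ω => Real.exp ((inner ℝ (u k) (l ω)) ^ 2 / η ^ 2)
  let F : Fin 2 → Ω → ℝ := fun k ω => Real.exp ((inner ℝ (w k) (r ω)) ^ 2 / η ^ 2)
  have hEF : ∀ k, Integrable (fun ω => (E k ω + F k ω) / 2) P := fun k =>
    ((hL k).1.add (hR k).1).div_const 2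
  have hint : Integrable
      (fun ω => ((E 0 ω + F 0 ω) / 2 + (E 1 ω + F 1 ω) / 2) / 2) P :=
    ((hEF 0).add (hEF 1)).div_const 2
  have hle : ∀ ω, Real.exp (1 / (2 * η ^ 2) * |(l ω).ofLp ⬝ᵥ (sumOuter u w *ᵥ (r ω).ofLp)|) ≤
      ((E 0 ω + F 0 ω) / 2 + (E 1 ω + F 1 ω) / 2) / 2 := by
    intro ω
    rw [dotProduct_sumOuter_mulVec, Fin.sum_univ_two]
    have hprod : ∀ s t : ℝ, |s * t| ≤ (s ^ 2 + t ^ 2) / 2 := fun s t => by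
      rw [abs_mul, ← sq_abs s, ← sq_abs t]
      nlinarith [sq_nonneg (|s| - |t|)]
    have h1 : 1 / (2 * η ^ 2) * |inner ℝ (u 0) (l ω) * inner ℝ (w 0) (r ω) +
        inner ℝ (u 1) (l ω) * inner ℝ (w 1) (r ω)| ≤
        (((inner ℝ (u 0) (l ω)) ^ 2 / η ^ 2 + (inner ℝ (w 0) (r ω)) ^ 2 / η ^ 2) / 2 +
        ((inner ℝ (u 1) (l ω)) ^ 2 / η ^ 2 + (inner ℝ (w 1) (r ω)) ^ 2 / η ^ 2) / 2) / 2 := by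
      calc _ ≤ 1 / (2 * η ^ 2) * (((inner ℝ (u 0) (l ω)) ^ 2 + (inner ℝ (w 0) (r ω)) ^ 2) / 2 +
            ((inner ℝ (u 1) (l ω)) ^ 2 + (inner ℝ (w 1) (r ω)) ^ 2) / 2) := by
            gcongr
            exact (abs_add_le _ _).trans (add_le_add (hprod _ _) (hprod _ _))
        _ = _ := by field_simp
    refine (Real.exp_le_exp.2 h1).trans ((exp_half_add_le _ _).trans ?_)
    gcongr
    · exact exp_half_add_le _ _
    · exact exp_half_add_le _ _
  have hmeas : AEMeasurable (fun ω => (l ω).ofLp ⬝ᵥ (sumOuter u w *ᵥ (r ω).ofLp)) P :=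
    (measurable_dotProduct_mulVec (sumOuter u w)).comp_aemeasurable (hl.1.prodMk hr.1)
  have hfin : Integrable (fun ω => Real.exp (1 / (2 * η ^ 2) *
      |(l ω).ofLp ⬝ᵥ (sumOuter u w *ᵥ (r ω).ofLp)|)) P := by
    refine hint.mono' (hmeas.abs.const_mul _).exp.aestronglyMeasurable (.of_forall fun ω => ?_)
    rw [Real.norm_eq_abs, Real.abs_exp]
    exact hle ω
  refine ⟨hfin, (integral_mono hfin hint hle).trans ?_⟩
  have hval : ∀ k, ∫ ω, (E k ω + F k ω) / 2 ∂P ≤ 2 := fun k => by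
    rw [integral_div, integral_add (hL k).1 (hR k).1]
    linarith [(hL k).2, (hR k).2]
  rw [integral_div, integral_add (hEF 0) (hEF 1)]
  linarith [hval 0, hval 1]

/-- Markov's inequality and homogeneity turn the small-ball condition into a bound on the mean. -/
theorem IsNondegenerate.le_integral {Ω : Type*} [MeasurableSpace Ω] {P : Measure Ω}
    [IsProbabilityMeasure P] {d₁ d₂ : ℕ} {μ₀ p₀ : ℝ} (hμ₀ : 0 < μ₀)
    {l : Ω → EuclideanSpace ℝ (Fin d₁)} {r : Ω → EuclideanSpace ℝ (Fin d₂)}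
    (h : IsNondegenerate μ₀ p₀ l r P) {X : Matrix (Fin d₁) (Fin d₂) ℝ} (hX : X.rank ≤ 2)
    (hint : Integrable (fun ω => |(l ω).ofLp ⬝ᵥ (X *ᵥ (r ω).ofLp)|) P) :
    μ₀ * p₀ * ‖X‖ ≤ ∫ ω, |(l ω).ofLp ⬝ᵥ (X *ᵥ (r ω).ofLp)| ∂P := by
  rcases eq_or_ne X 0 with rfl | hX0
  · simp
  have hn : 0 < ‖X‖ := norm_pos_iff.2 hX0
  have hP : ENNReal.ofReal p₀ ≤ P {ω | μ₀ * ‖X‖ ≤ |(l ω).ofLp ⬝ᵥ (X *ᵥ (r ω).ofLp)|} := by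
    have h1 : ENNReal.ofReal p₀ ≤
        P {ω | μ₀ ≤ |(l ω).ofLp ⬝ᵥ ((‖X‖⁻¹ • X) *ᵥ (r ω).ofLp)|} := by
      refine h.trans (iInf_le_of_le _ (iInf₂_le_of_le ?_ ?_ le_rfl))
      · rw [← Matrix.mul_one X, ← Matrix.mul_smul]
        exact (Matrix.rank_mul_le_left _ _).trans hX
      · let := Matrix.frobeniusNormedSpace (m := Fin d₁) (n := Fin d₂) (R := ℝ) (α := ℝ)
        rw [norm_smul, norm_inv, norm_norm, inv_mul_cancel₀ hn.ne']
    convert! h1 using 4 with ω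
    rw [Matrix.smul_mulVec, dotProduct_smul, smul_eq_mul, abs_mul, abs_inv, abs_norm,
      inv_mul_eq_div, le_div_iff₀ hn]
  have hM := mul_meas_ge_le_integral_of_nonneg (.of_forall fun ω => abs_nonneg _) hint
    (μ₀ * ‖X‖)
  calc μ₀ * p₀ * ‖X‖ = μ₀ * ‖X‖ * p₀ := by ring
    _ ≤ _ := by
        refine le_trans ?_ hM
        gcongr
        exact (ENNReal.ofReal_le_iff_le_toReal (measure_ne_top _ _)).1 hP

/-! ### Signed sums of measurements -/

theorem IsRandomMeasurementModel.subGaussian_left_apply {Ω Ω' : Type*} [MeasurableSpace Ω]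
    [MeasurableSpace Ω'] {P : Measure Ω} {P' : Measure Ω'} {d₁ d₂ m : ℕ} {μ₀ p₀ η : ℝ}
    {l : Ω' → EuclideanSpace ℝ (Fin d₁)} {r : Ω' → EuclideanSpace ℝ (Fin d₂)}
    {L : Fin m → Ω → EuclideanSpace ℝ (Fin d₁)} {R : Fin m → Ω → EuclideanSpace ℝ (Fin d₂)}
    (H : IsRandomMeasurementModel μ₀ p₀ η l r P' L R P) (i : Fin m) :
    IsSubGaussianVector η (L i) P :=
  H.subGaussian_left.of_identDistrib ((H.identDistrib i).comp measurable_fst)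

theorem IsRandomMeasurementModel.subGaussian_right_apply {Ω Ω' : Type*} [MeasurableSpace Ω]
    [MeasurableSpace Ω'] {P : Measure Ω} {P' : Measure Ω'} {d₁ d₂ m : ℕ} {μ₀ p₀ η : ℝ}
    {l : Ω' → EuclideanSpace ℝ (Fin d₁)} {r : Ω' → EuclideanSpace ℝ (Fin d₂)}
    {L : Fin m → Ω → EuclideanSpace ℝ (Fin d₁)} {R : Fin m → Ω → EuclideanSpace ℝ (Fin d₂)}
    (H : IsRandomMeasurementModel μ₀ p₀ η l r P' L R P) (i : Fin m) :
    IsSubGaussianVector η (R i) P :=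
  H.subGaussian_right.of_identDistrib ((H.identDistrib i).comp measurable_snd)

/-- Lower tail of a signed sum of measurements of one matrix `∑ₖ uₖ wₖᵀ`: the mean is at least
`2 κ δ m` where `δ m` is the sum of the signs, and falling below half of it has probability
`exp (-Ω(δ² m))`. -/
theorem IsRandomMeasurementModel.measureReal_signedSum_le {Ω Ω' : Type*} [MeasurableSpace Ω]
    [MeasurableSpace Ω'] {P : Measure Ω} {P' : Measure Ω'} [IsProbabilityMeasure P]
    [IsProbabilityMeasure P'] {d₁ d₂ m : ℕ} {μ₀ p₀ η : ℝ} (hμ₀ : 0 < μ₀) (hη : 0 < η)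
    {l : Ω' → EuclideanSpace ℝ (Fin d₁)} {r : Ω' → EuclideanSpace ℝ (Fin d₂)}
    {L : Fin m → Ω → EuclideanSpace ℝ (Fin d₁)} {R : Fin m → Ω → EuclideanSpace ℝ (Fin d₂)}
    (H : IsRandomMeasurementModel μ₀ p₀ η l r P' L R P)
    {s : Fin m → ℝ} {δ : ℝ} (hs : ∀ i, |s i| ≤ 1) (hsum : ∑ i, s i = δ * m) (hδ : 0 < δ)
    (hδ1 : δ ≤ 1) {a κ : ℝ} (ha : 0 < a) (ha1 : a ≤ 1 / (2 * η ^ 2) / 2)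
    (ha2 : 16 / (1 / (2 * η ^ 2)) ^ 2 * a ≤ κ / 2)
    {u : Fin 2 → EuclideanSpace ℝ (Fin d₁)} {w : Fin 2 → EuclideanSpace ℝ (Fin d₂)}
    (hu : ∀ k, ‖u k‖ ≤ 1) (hw : ∀ k, ‖w k‖ ≤ 1) (hκ : 2 * κ ≤ μ₀ * p₀ * ‖sumOuter u w‖) :
    P.real {ω | ∑ i, s i * |(L i ω).ofLp ⬝ᵥ (sumOuter u w *ᵥ (R i ω).ofLp)| ≤ κ * δ * m} ≤
      Real.exp (-(a * κ / 2 * δ ^ 2 * m)) := by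
  set θ : ℝ := 1 / (2 * η ^ 2) with hθdef
  have hθ : 0 < θ := by positivity
  let g : EuclideanSpace ℝ (Fin d₁) × EuclideanSpace ℝ (Fin d₂) → ℝ :=
    fun p => |p.1.ofLp ⬝ᵥ (sumOuter u w *ᵥ p.2.ofLp)|
  have hg : Measurable g := (measurable_dotProduct_mulVec (sumOuter u w)).abs
  let Y : Fin m → Ω → ℝ := fun i ω => g (L i ω, R i ω)
  have hYm : ∀ i, AEMeasurable (Y i) P := fun i =>
    hg.comp_aemeasurable (H.identDistrib i).aemeasurable_fst
  have hYexp := fun i => integrable_exp_abs_sumOuter hη (H.subGaussian_left_apply i)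
    (H.subGaussian_right_apply i) hu hw
  set M : ℝ := ∫ ω, g (l ω, r ω) ∂P' with hM
  have hYint : ∀ i, ∫ ω, Y i ω ∂P = M := fun i => ((H.identDistrib i).comp hg).integral_eq
  have hMκ : 2 * κ ≤ M := by
    refine hκ.trans (H.nondegenerate.le_integral hμ₀ (rank_sumOuter_le u w) ?_)
    exact integrable_of_integrable_exp hθ
      (hg.comp_aemeasurable (H.subGaussian_left.1.prodMk H.subGaussian_right.1))
      (fun ω => abs_nonneg _)
      (integrable_exp_abs_sumOuter hη H.subGaussian_left H.subGaussian_right hu hw).1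
  -- Chernoff's method for `-∑ sᵢ Yᵢ` with parameter `a δ`.
  have hts : ∀ i, |-(a * δ) * s i| ≤ θ / 2 := fun i => by
    rw [abs_mul, abs_neg, abs_of_pos (by positivity)]
    calc a * δ * |s i| ≤ a * 1 * 1 := by gcongr; exact hs i
      _ ≤ θ / 2 := by linarith
  have hmgf : ∀ i, ∫ ω, Real.exp (-(a * δ) * s i * Y i ω) ∂P ≤
      Real.exp (-(a * δ) * M * s i + 16 / θ ^ 2 * (a * δ) ^ 2) := fun i => by
    refine (integral_exp_mul_le hθ (hts i) (hYm i) (fun ω => abs_nonneg _) (hYexp i).1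
      (hYexp i).2).trans (Real.exp_le_exp.2 ?_)
    rw [hYint]
    have h1 : (s i) ^ 2 ≤ 1 := (sq_le_one_iff_abs_le_one _).2 (hs i)
    have h2 : (-(a * δ) * s i) ^ 2 ≤ (a * δ) ^ 2 := by
      rw [mul_pow, neg_sq]
      exact mul_le_of_le_one_right (sq_nonneg _) h1
    have h3 : 16 / θ ^ 2 * (-(a * δ) * s i) ^ 2 ≤ 16 / θ ^ 2 * (a * δ) ^ 2 := by gcongr
    linarith
  have hch := measureReal_sum_ge_le_exp (X := fun i ω => -(a * δ) * s i * Y i ω)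
    (H.iIndep.comp (fun i p => -(a * δ) * s i * g p) fun i => hg.const_mul _)
    (fun i => (hYm i).const_mul _) _
    (fun i => integrable_exp_mul_of_abs_le ((hts i).trans (by linarith)) (hYm i)
      (fun ω => abs_nonneg _) (hYexp i).1) hmgf (-(a * δ) * (κ * δ * m))
  refine le_trans (measureReal_mono fun ω hω => ?_) (hch.trans (Real.exp_le_exp.2 ?_))
  · simp only [Set.mem_ofPred_eq, mul_assoc, ← Finset.mul_sum] at hω ⊢
    rw [neg_mul, neg_mul, neg_le_neg_iff]
    exact mul_le_mul_of_nonneg_left hω (by positivity)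
  · rw [Finset.sum_add_distrib, ← Finset.mul_sum, hsum]
    simp only [Finset.sum_const, Finset.card_univ, Fintype.card_fin, nsmul_eq_mul]
    have h1 : a * δ ^ 2 * m * (2 * κ) ≤ a * δ ^ 2 * m * M := by gcongr
    have h2 : a * δ ^ 2 * m * (16 / θ ^ 2 * a) ≤ a * δ ^ 2 * m * (κ / 2) := by gcongr
    linarith

theorem exists_eq_smul_sumOuter_of_rank_le_two {d₁ d₂ : ℕ} {X : Matrix (Fin d₁) (Fin d₂) ℝ}
    (hX : X.rank ≤ 2) (hX0 : X ≠ 0) :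
    ∃ (u : Fin 2 → EuclideanSpace ℝ (Fin d₁)) (w : Fin 2 → EuclideanSpace ℝ (Fin d₂)),
      (∀ k, ‖u k‖ ≤ 1) ∧ (∀ k, ‖w k‖ ≤ 1) ∧ ‖sumOuter u w‖ = 1 ∧ X = ‖X‖ • sumOuter u w := by
  have hn : 0 < ‖X‖ := norm_pos_iff.2 hX0
  obtain ⟨u, w, hu, hw, h⟩ := exists_eq_sumOuter_of_rank_le_two X hX
  have hsm : sumOuter u (fun k => ‖X‖⁻¹ • w k) = ‖X‖⁻¹ • X := by
    rw [eq_inv_smul_iff₀ hn.ne']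
    conv_rhs => rw [h]
    simp only [sumOuter, WithLp.ofLp_smul, Matrix.vecMulVec_smul, ← Finset.smul_sum]
    rw [smul_inv_smul₀ hn.ne']
  refine ⟨u, fun k => ‖X‖⁻¹ • w k, hu, fun k => ?_, ?_, ?_⟩
  · rw [norm_smul, norm_inv, norm_norm, inv_mul_le_one₀ hn]
    exact hw k
  · let := Matrix.frobeniusNormedSpace (m := Fin d₁) (n := Fin d₂) (R := ℝ) (α := ℝ)
    rw [hsm, norm_smul, norm_inv, norm_norm, inv_mul_cancel₀ hn.ne']
  · rw [hsm, smul_inv_smul₀ hn.ne']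

theorem measurementMap_smul_sumOuter {d₁ d₂ m : ℕ} (l : Fin m → EuclideanSpace ℝ (Fin d₁))
    (r : Fin m → EuclideanSpace ℝ (Fin d₂)) (c : ℝ) (u : Fin 2 → EuclideanSpace ℝ (Fin d₁))
    (w : Fin 2 → EuclideanSpace ℝ (Fin d₂)) (i : Fin m) :
    measurementMap l r (c • sumOuter u w) i =
      c * ∑ k, inner ℝ (u k) (l i) * inner ℝ (w k) (r i) := by
  rw [map_smul, Pi.smul_apply, smul_eq_mul, ← dotProduct_sumOuter_mulVec]
  rfl

/-- A perturbation of the factors by `ε` changes a signed sum by at most `4 ε K`, where `K` bounds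
the bilinear form `∑ |⟨a, lᵢ⟩ ⟨b, rᵢ⟩|` on the unit balls. -/
theorem signedSum_le_add_of_norm_sub_le {d₁ d₂ m : ℕ} {l : Fin m → EuclideanSpace ℝ (Fin d₁)}
    {r : Fin m → EuclideanSpace ℝ (Fin d₂)} {K ε : ℝ} (hK0 : 0 ≤ K)
    (hK : ∀ a b, ∑ i, |inner ℝ a (l i) * inner ℝ b (r i)| ≤ K * (‖a‖ * ‖b‖))
    {s : Fin m → ℝ} (hs : ∀ i, |s i| ≤ 1)
    {u u' : Fin 2 → EuclideanSpace ℝ (Fin d₁)} {w w' : Fin 2 → EuclideanSpace ℝ (Fin d₂)}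
    (hu' : ∀ k, ‖u' k‖ ≤ 1) (hw : ∀ k, ‖w k‖ ≤ 1)
    (hu : ∀ k, ‖u k - u' k‖ ≤ ε) (hw' : ∀ k, ‖w k - w' k‖ ≤ ε) :
    ∑ i, s i * |∑ k, inner ℝ (u' k) (l i) * inner ℝ (w' k) (r i)| ≤
      ∑ i, s i * |∑ k, inner ℝ (u k) (l i) * inner ℝ (w k) (r i)| + 4 * ε * K := by
  have hε : 0 ≤ ε := (norm_nonneg _).trans (hu 0)
  have hpt : ∀ i, s i * |∑ k, inner ℝ (u' k) (l i) * inner ℝ (w' k) (r i)| ≤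
      s i * |∑ k, inner ℝ (u k) (l i) * inner ℝ (w k) (r i)| +
        ∑ k, (|inner ℝ (u k - u' k) (l i) * inner ℝ (w k) (r i)| +
          |inner ℝ (u' k) (l i) * inner ℝ (w k - w' k) (r i)|) := by
    intro i
    set A := ∑ k, inner ℝ (u' k) (l i) * inner ℝ (w' k) (r i) with hA
    set B := ∑ k, inner ℝ (u k) (l i) * inner ℝ (w k) (r i) with hB
    have h1 : |A - B| ≤ ∑ k, (|inner ℝ (u k - u' k) (l i) * inner ℝ (w k) (r i)| +
          |inner ℝ (u' k) (l i) * inner ℝ (w k - w' k) (r i)|) := by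
      rw [abs_sub_comm, hA, hB, ← Finset.sum_sub_distrib]
      refine (Finset.abs_sum_le_sum_abs _ _).trans (Finset.sum_le_sum fun k _ => ?_)
      refine le_trans (le_of_eq ?_) (abs_add_le _ _)
      rw [inner_sub_left, inner_sub_left]
      ring_nf
    have h2 : s i * (|A| - |B|) ≤ |A - B| := by
      calc s i * (|A| - |B|) ≤ |s i * (|A| - |B|)| := le_abs_self _
        _ = |s i| * |(|A| - |B|)| := abs_mul _ _
        _ ≤ 1 * |A - B| :=
          mul_le_mul (hs i) (abs_abs_sub_abs_le A B) (abs_nonneg _) zero_le_one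
        _ = _ := one_mul _
    linarith
  calc _ ≤ _ := Finset.sum_le_sum fun i _ => hpt i
    _ = ∑ i, s i * |∑ k, inner ℝ (u k) (l i) * inner ℝ (w k) (r i)| +
        ∑ k, (∑ i, |inner ℝ (u k - u' k) (l i) * inner ℝ (w k) (r i)| +
          ∑ i, |inner ℝ (u' k) (l i) * inner ℝ (w k - w' k) (r i)|) := by
        rw [Finset.sum_add_distrib, Finset.sum_comm]
        simp only [Finset.sum_add_distrib]
    _ ≤ ∑ i, s i * |∑ k, inner ℝ (u k) (l i) * inner ℝ (w k) (r i)| +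
        ∑ k : Fin 2, (K * (ε * 1) + K * (1 * ε)) := by
        gcongr with k
        · refine (hK _ _).trans ?_
          gcongr
          · exact hu k
          · exact hw k
        · refine (hK _ _).trans ?_
          gcongr
          · exact hu' k
          · exact hw' k
    _ = _ := by rw [Fin.sum_univ_two]; ring

/-- The size of the net of factors at scale `e δ` is dominated by the deviation exponent as soon
as `m` satisfies the sample size condition. -/
theorem net_card_le_exp {n : ℕ} {N₁ N₂ D m δ e b : ℝ} {d₁ d₂ : ℕ} (hn : n = d₁ + d₂)
    (hN : N₁ ≤ (1 + 2 / (e * δ)) ^ d₁) (hN' : N₂ ≤ (1 + 2 / (e * δ)) ^ d₂) (hN0 : 0 ≤ N₁)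
    (hN0' : 0 ≤ N₂) (hD : (n : ℝ) ≤ D) (hδ : 0 < δ) (he : 0 < e) (hb : 0 < b)
    (hm : (1 + 4 / b) * D / δ ^ 2 * Real.log ((3 + 2 / e) + (3 + 2 / e) / δ) ≤ m) :
    N₁ ^ 2 * N₂ ^ 2 ≤ Real.exp (b / 2 * δ ^ 2 * m) := by
  set q : ℝ := 1 + 2 / (e * δ) with hq
  set Q : ℝ := (3 + 2 / e) + (3 + 2 / e) / δ with hQ
  have hq1 : 1 ≤ q := by rw [hq]; linarith [show 0 < 2 / (e * δ) by positivity]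
  have hqQ : q ≤ Q := by
    have h1 : 2 / (e * δ) = 2 / e / δ := by rw [div_div]
    have h2 : Q = q + (2 + 2 / e + 3 / δ) := by rw [hQ, hq, h1]; ring
    rw [h2]
    exact le_add_of_nonneg_right (by positivity)
  have hlog : 0 ≤ Real.log Q := Real.log_nonneg (hq1.trans hqQ)
  have hD0 : 0 ≤ D := (Nat.cast_nonneg n).trans hD
  calc N₁ ^ 2 * N₂ ^ 2 ≤ (q ^ d₁) ^ 2 * (q ^ d₂) ^ 2 := by gcongr
    _ = q ^ (2 * n) := by rw [hn]; ring
    _ ≤ Q ^ (2 * n) := by gcongr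
    _ = Real.exp (2 * n * Real.log Q) := by
        have hQ0 : 0 < Q := by linarith
        rw [← Real.exp_log (show 0 < Q ^ (2 * n) by positivity), Real.log_pow]
        push_cast
        rfl
    _ ≤ Real.exp (2 * D * Real.log Q) := by gcongr
    _ ≤ Real.exp (b / 2 * δ ^ 2 * m) := by
        refine Real.exp_le_exp.2 ?_
        have h1 : 4 / b * D / δ ^ 2 * Real.log Q ≤ m := by
          refine le_trans ?_ hm
          gcongr
          linarith
        calc 2 * D * Real.log Q = b / 2 * δ ^ 2 * (4 / b * D / δ ^ 2 * Real.log Q) := by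
              field_simp; ring
          _ ≤ _ := by gcongr

/-- Uniform lower bound for signed sums of measurements. Outside an event of probability
`exp (-Ω(δ² m))`, boundedness of the bilinear form `∑ |⟨a, lᵢ⟩ ⟨b, rᵢ⟩|` carries the bound from a
net of factors to all matrices of rank at most two. -/
theorem IsRandomMeasurementModel.exists_forall_le_signedSum {Ω Ω' : Type*} [MeasurableSpace Ω]
    [MeasurableSpace Ω'] {P : Measure Ω} {P' : Measure Ω'} [IsProbabilityMeasure P]
    [IsProbabilityMeasure P'] {d₁ d₂ m : ℕ} {μ₀ p₀ η : ℝ} (hμ₀ : 0 < μ₀) (hη : 0 < η)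
    {l : Ω' → EuclideanSpace ℝ (Fin d₁)} {r : Ω' → EuclideanSpace ℝ (Fin d₂)}
    {L : Fin m → Ω → EuclideanSpace ℝ (Fin d₁)} {R : Fin m → Ω → EuclideanSpace ℝ (Fin d₂)}
    (H : IsRandomMeasurementModel μ₀ p₀ η l r P' L R P)
    {s : Fin m → ℝ} {δ : ℝ} (hs : ∀ i, |s i| ≤ 1) (hsum : ∑ i, s i = δ * m) (hδ : 0 < δ)
    (hδ1 : δ ≤ 1) {a κ e : ℝ} (ha : 0 < a) (ha1 : a ≤ 1 / (2 * η ^ 2) / 2)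
    (ha2 : 16 / (1 / (2 * η ^ 2)) ^ 2 * a ≤ κ / 2) (hκ0 : 0 < κ) (hκ : 4 * κ ≤ μ₀ * p₀)
    (he : 0 < e) (he1 : e ≤ 1 / 8) (he2 : 64 * η ^ 2 * e ≤ κ / 2)
    (hm : (1 + 4 / (a * κ / 2)) * ((d₁ : ℝ) + d₂ + 1) / δ ^ 2 *
      Real.log ((3 + 2 / e) + (3 + 2 / e) / δ) ≤ m) :
    ∃ B : Set Ω, P.real B ≤ Real.exp (-(a * κ / 2 / 2 * δ ^ 2 * m)) ∧
      ∀ ω ∉ B, (∀ x y, ∑ i, |inner ℝ x (L i ω) * inner ℝ y (R i ω)| ≤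
          16 * η ^ 2 * m * (‖x‖ * ‖y‖)) →
        ∀ X : Matrix (Fin d₁) (Fin d₂) ℝ, X.rank ≤ 2 →
          κ / 2 * δ * m * ‖X‖ ≤
            ∑ i, s i * |measurementMap (fun i => L i ω) (fun i => R i ω) X i| := by
  classical
  have heδ : 0 < e * δ := by positivity
  obtain ⟨N₁, hN₁, hN₁', hN₁c⟩ := exists_finset_net_unitBall (EuclideanSpace ℝ (Fin d₁)) heδ
  obtain ⟨N₂, hN₂, hN₂', hN₂c⟩ := exists_finset_net_unitBall (EuclideanSpace ℝ (Fin d₂)) heδ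
  rw [finrank_euclideanSpace_fin] at hN₁c hN₂c
  let T : Finset ((Fin 2 → EuclideanSpace ℝ (Fin d₁)) × (Fin 2 → EuclideanSpace ℝ (Fin d₂))) :=
    (Fintype.piFinset (fun _ => N₁) ×ˢ Fintype.piFinset (fun _ => N₂)).filter
      fun p => 1 / 2 ≤ ‖sumOuter p.1 p.2‖
  have hTmem : ∀ p ∈ T, (∀ k, p.1 k ∈ N₁) ∧ (∀ k, p.2 k ∈ N₂) ∧
      1 / 2 ≤ ‖sumOuter p.1 p.2‖ := fun p hp => by
    simpa [T, Finset.mem_filter, Fintype.mem_piFinset, and_assoc] using hp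
  have hTc : (T.card : ℝ) ≤ (N₁.card : ℝ) ^ 2 * (N₂.card : ℝ) ^ 2 := by
    have h := Finset.card_filter_le
      (Fintype.piFinset (fun _ : Fin 2 => N₁) ×ˢ Fintype.piFinset (fun _ : Fin 2 => N₂))
      (fun p => 1 / 2 ≤ ‖sumOuter p.1 p.2‖)
    rw [Finset.card_product, Fintype.card_piFinset_const, Fintype.card_piFinset_const] at h
    exact_mod_cast h
  refine ⟨⋃ p ∈ T, {ω | ∑ i, s i * |(L i ω).ofLp ⬝ᵥ (sumOuter p.1 p.2 *ᵥ (R i ω).ofLp)| ≤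
    κ * δ * m}, ?_, fun ω hω hK X hX => ?_⟩
  · calc _ ≤ ∑ p ∈ T, P.real {ω | ∑ i, s i * |(L i ω).ofLp ⬝ᵥ
            (sumOuter p.1 p.2 *ᵥ (R i ω).ofLp)| ≤ κ * δ * m} := measureReal_biUnion_finset_le _ _
      _ ≤ ∑ p ∈ T, Real.exp (-(a * κ / 2 * δ ^ 2 * m)) := by
          refine Finset.sum_le_sum fun p hp => ?_
          obtain ⟨h1, h2, h3⟩ := hTmem p hp
          refine H.measureReal_signedSum_le hμ₀ hη hs hsum hδ hδ1 ha ha1 ha2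
            (fun k => hN₁ _ (h1 k)) (fun k => hN₂ _ (h2 k)) ?_
          have := mul_le_mul hκ h3 (by norm_num) (by linarith)
          linarith
      _ = T.card * Real.exp (-(a * κ / 2 * δ ^ 2 * m)) := by simp
      _ ≤ Real.exp (a * κ / 2 / 2 * δ ^ 2 * m) * Real.exp (-(a * κ / 2 * δ ^ 2 * m)) := by
          gcongr
          exact hTc.trans (net_card_le_exp rfl hN₁c hN₂c (by positivity) (by positivity)
            (by push_cast; linarith) hδ he (by positivity) hm)
      _ = _ := by rw [← Real.exp_add]; ring_nf
  · rcases eq_or_ne X 0 with rfl | hX0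
    · simp
    obtain ⟨u, w, hu, hw, hnorm, hXeq⟩ := exists_eq_smul_sumOuter_of_rank_le_two hX hX0
    choose u' hu'N hu' using fun k => hN₁' (u k) (hu k)
    choose w' hw'N hw' using fun k => hN₂' (w k) (hw k)
    have hu'1 : ∀ k, ‖u' k‖ ≤ 1 := fun k => hN₁ _ (hu'N k)
    -- The net matrix has norm at least `1 / 2`, as it is within `4 e δ ≤ 1 / 2` of norm one.
    have hT : (u', w') ∈ T := by
      have h1 := norm_sumOuter_sub_le hu'1 hw hu' hw'
      have h2 := norm_sub_norm_le (sumOuter u w) (sumOuter u' w')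
      have h3 : e * δ ≤ 1 / 8 * 1 := by gcongr
      have h4 : 1 / 2 ≤ ‖sumOuter u' w'‖ := by linarith
      exact Finset.mem_filter.2 ⟨Finset.mem_product.2
        ⟨Fintype.mem_piFinset.2 hu'N, Fintype.mem_piFinset.2 hw'N⟩, h4⟩
    simp only [Set.mem_iUnion, Set.mem_ofPred_eq, not_exists, not_le] at hω
    have hnet := hω _ hT
    simp only [dotProduct_sumOuter_mulVec] at hnet
    have hpert := signedSum_le_add_of_norm_sub_le (by positivity) hK hs hu'1 hw hu' hw'
    have herr : 4 * (e * δ) * (16 * η ^ 2 * m) ≤ κ / 2 * (δ * m) := by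
      calc _ = 64 * η ^ 2 * e * (δ * m) := by ring
        _ ≤ _ := by gcongr
    have hfin : κ / 2 * δ * m ≤
        ∑ i, s i * |∑ k, inner ℝ (u k) (L i ω) * inner ℝ (w k) (R i ω)| := by linarith
    have hn := norm_nonneg X
    calc κ / 2 * δ * m * ‖X‖
        ≤ (∑ i, s i * |∑ k, inner ℝ (u k) (L i ω) * inner ℝ (w k) (R i ω)|) * ‖X‖ := by gcongr
      _ = ∑ i, s i * |measurementMap (fun i => L i ω) (fun i => R i ω) X i| := by
          rw [Finset.sum_mul]
          refine Finset.sum_congr rfl fun i _ => ?_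
          rw [hXeq, measurementMap_smul_sumOuter, ← hXeq, abs_mul, abs_norm]
          ring

/-! ### The four failure events -/

theorem sum_abs_inner_mul_inner_le {d₁ d₂ m : ℕ} {l : Fin m → EuclideanSpace ℝ (Fin d₁)}
    {r : Fin m → EuclideanSpace ℝ (Fin d₂)} {K : ℝ} (hK : 0 ≤ K)
    (hl : ∀ x, ∑ i, (inner ℝ x (l i)) ^ 2 ≤ K * ‖x‖ ^ 2)
    (hr : ∀ y, ∑ i, (inner ℝ y (r i)) ^ 2 ≤ K * ‖y‖ ^ 2) (x : EuclideanSpace ℝ (Fin d₁))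
    (y : EuclideanSpace ℝ (Fin d₂)) :
    ∑ i, |inner ℝ x (l i) * inner ℝ y (r i)| ≤ K * (‖x‖ * ‖y‖) := by
  refine abs_le_of_sq_le_sq' ?_ (by positivity) |>.2
  have h := Finset.sum_mul_sq_le_sq_mul_sq Finset.univ (fun i => |inner ℝ x (l i)|)
    fun i => |inner ℝ y (r i)|
  simp only [sq_abs, ← abs_mul] at h
  calc _ ≤ _ := h
    _ ≤ (K * ‖x‖ ^ 2) * (K * ‖y‖ ^ 2) :=
      mul_le_mul (hl x) (hr y) (Finset.sum_nonneg fun i _ => sq_nonneg _) (by positivity)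
    _ = _ := by ring

theorem sum_abs_measurementMap_le {d₁ d₂ m : ℕ} {l : Fin m → EuclideanSpace ℝ (Fin d₁)}
    {r : Fin m → EuclideanSpace ℝ (Fin d₂)} {K : ℝ} (hK0 : 0 ≤ K)
    (hK : ∀ a b, ∑ i, |inner ℝ a (l i) * inner ℝ b (r i)| ≤ K * (‖a‖ * ‖b‖))
    {X : Matrix (Fin d₁) (Fin d₂) ℝ} (hX : X.rank ≤ 2) :
    ∑ i, |measurementMap l r X i| ≤ 2 * K * ‖X‖ := by
  rcases eq_or_ne X 0 with rfl | hX0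
  · simp
  obtain ⟨u, w, hu, hw, -, hXeq⟩ := exists_eq_smul_sumOuter_of_rank_le_two hX hX0
  calc ∑ i, |measurementMap l r X i|
      ≤ ∑ i, ‖X‖ * ∑ k, |inner ℝ (u k) (l i) * inner ℝ (w k) (r i)| := by
        refine Finset.sum_le_sum fun i _ => ?_
        rw [hXeq, measurementMap_smul_sumOuter, ← hXeq, abs_mul, abs_norm]
        gcongr
        exact Finset.abs_sum_le_sum_abs _ _
    _ = ‖X‖ * ∑ k, ∑ i, |inner ℝ (u k) (l i) * inner ℝ (w k) (r i)| := by
        rw [← Finset.mul_sum, Finset.sum_comm]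
    _ ≤ ‖X‖ * ∑ k : Fin 2, K * (1 * 1) := by
        gcongr with k
        refine (hK _ _).trans ?_
        gcongr
        · exact hu k
        · exact hw k
    _ = _ := by rw [Fin.sum_univ_two]; ring

theorem one_sub_le_measureReal_of_compl_subset {Ω : Type*} [MeasurableSpace Ω] {P : Measure Ω}
    [IsProbabilityMeasure P] {G B : Set Ω} (h : Gᶜ ⊆ B) : 1 - P.real B ≤ P.real G := by
  have h1 : P.real Set.univ ≤ P.real (G ∪ B) :=
    measureReal_mono (by
      intro ω _
      by_cases hω : ω ∈ G
      · exact .inl hω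
      · exact .inr (h hω))
  have h2 := measureReal_union_le (μ := P) G B
  rw [probReal_univ] at h1
  linarith

theorem mainTheorem1 (μ₀ p₀ η : ℝ) (hμ₀ : 0 < μ₀) (hp₀ : 0 < p₀) (hη : 0 < η) :
    ∃ c₁ c₂ c₃ c₄ c₅ c₆ : ℝ, 0 < c₁ ∧ 0 < c₂ ∧ 0 < c₃ ∧ 0 < c₄ ∧ 0 < c₅ ∧ 0 < c₆ ∧
      ∀ (d₁ d₂ m : ℕ) (I : Finset (Fin m)), (I.card : ℝ) < (m : ℝ) / 2 →
      ∀ (Ω Ω' : Type*) [MeasurableSpace Ω] [MeasurableSpace Ω']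
        (P : Measure Ω) (P' : Measure Ω') [IsProbabilityMeasure P] [IsProbabilityMeasure P']
        (l : Ω' → EuclideanSpace ℝ (Fin d₁)) (r : Ω' → EuclideanSpace ℝ (Fin d₂))
        (L : Fin m → Ω → EuclideanSpace ℝ (Fin d₁)) (R : Fin m → Ω → EuclideanSpace ℝ (Fin d₂)),
        IsRandomMeasurementModel μ₀ p₀ η l r P' L R P →
        c₁ * ((d₁ : ℝ) + d₂ + 1) / (1 - 2 * (I.card : ℝ) / m) ^ 2
            * Real.log (c₂ + c₂ / (1 - 2 * (I.card : ℝ) / m)) ≤ (m : ℝ) →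
        1 - 4 * Real.exp (-(c₃ * (1 - 2 * (I.card : ℝ) / m) ^ 2 * m)) ≤
          P.real {ω | ∀ X : Matrix (Fin d₁) (Fin d₂) ℝ, X.rank ≤ 2 →
            (c₄ * ‖X‖ ≤ 1 / (m : ℝ) *
                ∑ i, |measurementMap (fun i => L i ω) (fun i => R i ω) X i| ∧
              1 / (m : ℝ) * ∑ i, |measurementMap (fun i => L i ω) (fun i => R i ω) X i|
                ≤ c₅ * ‖X‖) ∧
            c₆ * (1 - 2 * (I.card : ℝ) / m) * ‖X‖ ≤
              1 / (m : ℝ) *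
                (∑ i ∈ Iᶜ, |measurementMap (fun i => L i ω) (fun i => R i ω) X i|
                  - ∑ i ∈ I, |measurementMap (fun i => L i ω) (fun i => R i ω) X i|)} := by
  classical
  obtain ⟨κ, hκdef⟩ : ∃ κ, κ = μ₀ * p₀ / 4 := ⟨_, rfl⟩
  have hκ0 : 0 < κ := by rw [hκdef]; positivity
  have hκ : 4 * κ ≤ μ₀ * p₀ := by rw [hκdef]; linarith
  -- `a` is the Chernoff parameter per unit of `δ`, `e` the net scale per unit of `δ`.
  obtain ⟨a, ha, ha1, ha2⟩ : ∃ a : ℝ, 0 < a ∧ a ≤ 1 / (2 * η ^ 2) / 2 ∧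
      16 / (1 / (2 * η ^ 2)) ^ 2 * a ≤ κ / 2 := by
    refine ⟨min (1 / (2 * η ^ 2) / 2) (κ / 2 / (16 / (1 / (2 * η ^ 2)) ^ 2)), by positivity,
      min_le_left _ _, ?_⟩
    rw [← le_div_iff₀' (by positivity)]
    exact min_le_right _ _
  obtain ⟨e, he, he1, he2⟩ : ∃ e : ℝ, 0 < e ∧ e ≤ 1 / 8 ∧ 64 * η ^ 2 * e ≤ κ / 2 := by
    refine ⟨min (1 / 8) (κ / 2 / (64 * η ^ 2)), by positivity, min_le_left _ _, ?_⟩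
    rw [← le_div_iff₀' (by positivity)]
    exact min_le_right _ _
  refine ⟨1 + 4 / (a * κ / 2), 3 + 2 / e, min (a * κ / 2 / 2) 1, κ / 2, 32 * η ^ 2, κ / 2,
    by positivity, by positivity, by positivity, by positivity, by positivity, by positivity, ?_⟩
  intro d₁ d₂ m I hI Ω Ω' _ _ P P' _ _ l r L R H hm
  have hm0 : (0 : ℝ) < m := by
    have := Nat.cast_nonneg (α := ℝ) I.card
    linarith
  obtain ⟨δ, hδdef⟩ : ∃ δ, δ = 1 - 2 * (I.card : ℝ) / m := ⟨_, rfl⟩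
  rw [← hδdef] at hm ⊢
  have hδm : δ * m = m - 2 * I.card := by rw [hδdef]; field_simp
  have hδ : 0 < δ := pos_of_mul_pos_left (by linarith) hm0.le
  have hδ1 : δ ≤ 1 := by
    rw [hδdef]
    linarith [show 0 ≤ 2 * (I.card : ℝ) / m by positivity]
  have hδsq : δ ^ 2 ≤ 1 := pow_le_one₀ hδ.le hδ1
  set c₁ : ℝ := 1 + 4 / (a * κ / 2) with hc₁
  set c₂ : ℝ := 3 + 2 / e with hc₂
  have hc₁1 : 1 ≤ c₁ := by rw [hc₁]; linarith [show 0 < 4 / (a * κ / 2) by positivity]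
  have hc₂3 : 3 ≤ c₂ := by rw [hc₂]; linarith [show 0 < 2 / e by positivity]
  -- The sample size condition at `δ` implies the one at `1`, and `d₁ + d₂ ≤ m`.
  have hlog1 : 1 ≤ Real.log (c₂ + c₂ / 1) := by
    rw [Real.le_log_iff_exp_le (by positivity)]
    linarith [Real.exp_one_lt_d9]
  have hm1 : c₁ * ((d₁ : ℝ) + d₂ + 1) / 1 ^ 2 * Real.log (c₂ + c₂ / 1) ≤ m := by
    refine le_trans ?_ hm
    gcongr
  have hdm : (d₁ : ℝ) + d₂ ≤ m := by
    calc (d₁ : ℝ) + d₂ ≤ 1 * ((d₁ : ℝ) + d₂ + 1) / 1 ^ 2 * 1 := by linarith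
      _ ≤ c₁ * ((d₁ : ℝ) + d₂ + 1) / 1 ^ 2 * Real.log (c₂ + c₂ / 1) := by gcongr
      _ ≤ m := hm1
  have hdm' : d₁ + d₂ ≤ m := by exact_mod_cast hdm
  obtain ⟨B₁, hB₁, hG₁⟩ := exists_measureReal_le_forall_sum_inner_sq_le hη
    (H.iIndep.comp (fun _ p => p.1) fun _ => measurable_fst) H.subGaussian_left_apply
    (by omega)
  obtain ⟨B₂, hB₂, hG₂⟩ := exists_measureReal_le_forall_sum_inner_sq_le hη
    (H.iIndep.comp (fun _ p => p.2) fun _ => measurable_snd) H.subGaussian_right_apply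
    (by omega)
  obtain ⟨B₃, hB₃, hG₃⟩ := H.exists_forall_le_signedSum hμ₀ hη (s := fun _ => 1) (δ := 1)
    (by simp) (by simp) one_pos le_rfl ha ha1 ha2 hκ0 hκ he he1 he2 hm1
  obtain ⟨B₄, hB₄, hG₄⟩ := H.exists_forall_le_signedSum hμ₀ hη
    (s := fun i => if i ∈ I then -1 else 1) (δ := δ)
    (fun i => by split_ifs <;> simp)
    (by
      rw [hδm, ← Finset.sum_add_sum_compl I, Finset.sum_congr rfl fun i hi => if_pos hi,
        Finset.sum_congr rfl fun i hi => if_neg (Finset.mem_compl.1 hi)]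
      simp only [Finset.sum_const, Finset.card_compl, Fintype.card_fin, nsmul_eq_mul]
      rw [Nat.cast_sub (by simpa using Finset.card_le_univ I)]
      ring)
    hδ hδ1 ha ha1 ha2 hκ0 hκ he he1 he2 hm
  set c₃ : ℝ := min (a * κ / 2 / 2) 1 with hc₃
  have hc₃0 : 0 ≤ c₃ := by positivity
  have hexp : ∀ x : ℝ, c₃ * δ ^ 2 * m ≤ x → Real.exp (-x) ≤ Real.exp (-(c₃ * δ ^ 2 * m)) :=
    fun x hx => Real.exp_le_exp.2 (neg_le_neg hx)
  have hB : P.real (B₁ ∪ B₂ ∪ B₃ ∪ B₄) ≤ 4 * Real.exp (-(c₃ * δ ^ 2 * m)) := by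
    have h1 := measureReal_union_le (μ := P) (B₁ ∪ B₂ ∪ B₃) B₄
    have h2 := measureReal_union_le (μ := P) (B₁ ∪ B₂) B₃
    have h3 := measureReal_union_le (μ := P) B₁ B₂
    have e1 := hexp m (by
      calc c₃ * δ ^ 2 * m ≤ 1 * 1 * m := by gcongr; exact min_le_right _ _
        _ = m := by ring)
    have e3 := hexp (a * κ / 2 / 2 * 1 ^ 2 * m) (by
      gcongr
      exact min_le_left _ _)
    have e4 := hexp (a * κ / 2 / 2 * δ ^ 2 * m) (by
      gcongr
      exact min_le_left _ _)
    linarith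
  refine le_trans (by linarith) (one_sub_le_measureReal_of_compl_subset
    (B := B₁ ∪ B₂ ∪ B₃ ∪ B₄) ?_)
  rw [Set.compl_subset_comm]
  intro ω hω X hX
  simp only [Set.mem_compl_iff, Set.mem_union, not_or] at hω
  obtain ⟨⟨⟨hω₁, hω₂⟩, hω₃⟩, hω₄⟩ := hω
  have hK := sum_abs_inner_mul_inner_le (l := fun i => L i ω) (r := fun i => R i ω)
    (K := 16 * η ^ 2 * m) (by positivity) (hG₁ ω hω₁) (hG₂ ω hω₂)
  have h3 := hG₃ ω hω₃ hK X hX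
  have h4 := hG₄ ω hω₄ hK X hX
  have h5 := sum_abs_measurementMap_le (by positivity) hK hX
  rw [← Finset.sum_add_sum_compl I,
    Finset.sum_congr (s₁ := I) rfl fun i hi => by rw [if_pos hi],
    Finset.sum_congr (s₁ := Iᶜ) rfl fun i hi => by rw [if_neg (Finset.mem_compl.1 hi)]] at h4
  simp only [one_mul, neg_mul, Finset.sum_neg_distrib] at h3 h4
  simp only [one_div, inv_mul_eq_div, le_div_iff₀ hm0, div_le_iff₀ hm0]
  refine ⟨⟨?_, ?_⟩, ?_⟩ <;> linarith
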